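/- Consider an asynchronous message-passing system of $n\ge 2$ processes $p_1,\dots,p_n$ running a deterministic protocol: in each step a process receives at most one of the messages in transit to it, changes its local state, and sends finitely many messages to processes (possibly itself); decisions are irrevocable. At most $f$ processes may crash (stop taking steps for ever); every message sent to a correct (non-crashed) process is eventually received, but message delays and relative process speeds are unbounded. A *lattice* is a join semilattice $(X,\le,\sqcup)$. A *quasi-metric* over $X$ is a function $\delta_X:X\times X\to[0,\infty]\cup\{\bot\}$ such that for all $a,b,c\in X$: $a=b\Leftrightarrow\delta_X(a,b)=0$; $a\le b\Leftrightarrow\delta_X(a,b)\ne\bot$; and $a\le b\le c$ implies $\delta_X(a,c)\le\delta_X(a,b)+\delta_X(b,c)$. For a real $\varepsilon\ge 0$, a protocol *solves $\varepsilon$-bounded lattice agreement over $(X,\delta_X)$ with at most $f$ faults* if for all inputs $x_1,\dots,x_n\in X$ and in every run with at most $f$ crashes, each correct process $p_i$ decides on some $y_i\in X$ such that for all correct $p_i,p_j$: $x_i\le y_i$; $y_i\le\bigsqcup_{k=1}^n x_k$; $y_i\le y_j$ or $y_j\le y_i$; and $y_i\le y_j$ implies $\delta_X(y_i,y_j)\le\varepsilon$.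 **Theorem.** Let $n\ge 2$, $f\ge 1$ and $\varepsilon\ge 0$. Then there is no asynchronous protocol (even one that may depend on the lattice, the quasi-metric, $n$, $f$ and $\varepsilon$) that solves $\varepsilon$-bounded lattice agreement with at most $f$ faults over all lattices and quasi-metrics. Moreover, there are a finite lattice $X$, a quasi-metric $\delta_X$ and inputs $x_1,\dots,x_n\in X$, not all equal, such that $\delta_X(a,b)>\varepsilon$ for all $a<b$ in the join-closed sub-semilattice generated by $x_1,\dots,x_n$, and no asynchronous protocol solves $\varepsilon$-bounded lattice agreement over $(X,\delta_X)$ with at most $f$ faults. -/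

import Mathlib

open scoped NNReal ENNReal

universe u v w

/-- A quasi-metric over a join semilattice `X`, with values in `[0, ∞] ∪ {⊥}`;
`⊥` marks the pairs `(a, b)` with `¬ a ≤ b`. -/
structure QuasiMetric (X : Type w) [SemilatticeSup X] where
  dist : X → X → WithBot ℝ≥0∞
  eq_iff : ∀ a b, a = b ↔ dist a b = 0
  le_iff : ∀ a b, a ≤ b ↔ dist a b ≠ ⊥
  triangle : ∀ a b c, a ≤ b → b ≤ c → dist a c ≤ dist a b + dist b c

/-- The real number `ε ≥ 0` as a possible value of a quasi-metric. -/
def boundValue (ε : ℝ≥0) : WithBot ℝ≥0∞ := ((ε : ℝ≥0∞) : WithBot ℝ≥0∞)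

/-- The requirements of `ε`-bounded lattice agreement on inputs `x` and outputs `y`, imposed on
the outputs of the processes in `C` (the correct ones). The join in `upward` is over the inputs of
all `n` processes. -/
structure IsBoundedLatticeAgreement {n : ℕ} {X : Type w} [SemilatticeSup X] (δ : QuasiMetric X)
    (ε : ℝ≥0) (C : Set (Fin n)) (x y : Fin n → X) : Prop where
  downward : ∀ i ∈ C, x i ≤ y i
  upward : ∀ i ∈ C, y i ≤ Finset.univ.sup' ⟨i, Finset.mem_univ i⟩ x
  comparable : ∀ i ∈ C, ∀ j ∈ C, y i ≤ y j ∨ y j ≤ y i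
  tight : ∀ i ∈ C, ∀ j ∈ C, y i ≤ y j → δ.dist (y i) (y j) ≤ boundValue ε

/-- A deterministic asynchronous message-passing protocol for `n` processes with inputs and
outputs in `X`. In one step a process receives at most one message (`none`: no message is
received), changes its state and sends finitely many messages, each to some process, possibly
itself. Decisions are irrevocable. -/
structure Protocol (n : ℕ) (X : Type w) where
  State : Type u
  Msg : Type v
  init : Fin n → X → State
  step : Fin n → State → Option Msg → State × Multiset (Fin n × Msg)
  decision : State → Option X
  decision_stable : ∀ i s m y, decision s = some y → decision (step i s m).1 = some y

namespace Protocol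

variable {n : ℕ} {X : Type w}

/-- A global configuration: the local states, and the messages in transit, each with its
destination. -/
structure Config (P : Protocol.{u, v} n X) where
  state : Fin n → P.State
  buffer : Multiset (Fin n × P.Msg)

/-- The messages consumed when process `i` receives `m`. -/
def consumed (P : Protocol.{u, v} n X) (i : Fin n) : Option P.Msg → Multiset (Fin n × P.Msg)
  | none => 0
  | some m => {(i, m)}

/-- Process `i` takes a step from `c` to `c'` in which it receives `m`. -/
def Step (P : Protocol.{u, v} n X) (c : P.Config) (i : Fin n) (m : Option P.Msg)
    (c' : P.Config) : Prop :=
  c'.state = Function.update c.state i (P.step i (c.state i) m).1 ∧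
    ∃ rest, c.buffer = P.consumed i m + rest ∧
      c'.buffer = rest + (P.step i (c.state i) m).2

/-- An infinite run of the protocol on the inputs `x`: at time `t` process `proc t` takes a step
in which it receives `recv t`. -/
structure Run (P : Protocol.{u, v} n X) (x : Fin n → X) where
  config : ℕ → P.Config
  proc : ℕ → Fin n
  recv : ℕ → Option P.Msg
  init_state : ∀ i, (config 0).state i = P.init i (x i)
  init_buffer : (config 0).buffer = 0
  step : ∀ t, P.Step (config t) (proc t) (recv t) (config (t + 1))

namespace Run

variable {P : Protocol.{u, v} n X} {x : Fin n → X}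

/-- The correct processes take infinitely many steps; the others crash, that is, take no step
from some time on. -/
def correct (ρ : P.Run x) : Set (Fin n) := {i | ∀ t, ∃ t', t ≤ t' ∧ ρ.proc t' = i}

/-- At most `f` processes crash, and every message in transit to a correct process is eventually
received; there is no bound on the delay or on the relative speed of the processes. -/
structure Admissible (ρ : P.Run x) (f : ℕ) : Prop where
  faults : ρ.correctᶜ.ncard ≤ f
  delivery : ∀ i ∈ ρ.correct, ∀ t m, (i, m) ∈ (ρ.config t).buffer →
    ∃ t', t ≤ t' ∧ ρ.proc t' = i ∧ ρ.recv t' = some m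

/-- Process `i` decides on the output `y` in the run. -/
def Decides (ρ : P.Run x) (i : Fin n) (y : X) : Prop :=
  ∃ t, P.decision ((ρ.config t).state i) = some y

end Run

/-- The protocol solves `ε`-bounded lattice agreement over `(X, δ)` in the asynchronous system
with at most `f` crash faults: for all inputs and all admissible runs, every correct process
decides, and the outputs of the correct processes meet the requirements. -/
def Solves [SemilatticeSup X] (P : Protocol.{u, v} n X) (δ : QuasiMetric X) (f : ℕ)
    (ε : ℝ≥0) : Prop :=
  ∀ (x : Fin n → X) (ρ : P.Run x), ρ.Admissible f →
    ∃ y : Fin n → X, (∀ i ∈ ρ.correct, ρ.Decides i (y i)) ∧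
      IsBoundedLatticeAgreement δ ε ρ.correct x y

end Protocol

/-! Inputs `a < b` at distance more than `ε` cannot both be decided. Give `b` to one process `p` and
`a` to all others, and let `p` be so slow that it takes no step at first. Another process `q` cannot
tell this from a run in which every input is `a` and `p` has crashed. In that run validity forces
`q` to decide `a`, which it does after finitely many steps. When `p` wakes up, validity forces it to
decide `b`. If each process receives its messages in first-in first-out order, then no message to a
process that takes infinitely many steps is lost, and the inputs and the order in which the
processes take steps determine the run. -/

open Filter Set

theorem exists_seq_frequently_eq {α : Type*} {S : Set α} (hne : S.Nonempty) (hS : S.Countable) :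
    ∃ σ : ℕ → α, (∀ t, σ t ∈ S) ∧ ∀ a ∈ S, ∃ᶠ t in atTop, σ t = a := by
  obtain ⟨g, rfl⟩ := hS.exists_eq_range hne
  refine ⟨fun t => g t.unpair.1, fun t => mem_range_self _, forall_mem_range.2 fun k => ?_⟩
  exact frequently_atTop.2 fun t => ⟨Nat.pair k t, Nat.right_le_pair k t, by simp⟩

theorem exists_next_eq {α : Type*} {σ : ℕ → α} {a : α} (ha : ∃ᶠ t in atTop, σ t = a) (t : ℕ) :
    ∃ t', t ≤ t' ∧ σ t' = a ∧ ∀ s ∈ Ico t t', σ s ≠ a := by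
  classical
  have hex := frequently_atTop.1 ha t
  exact ⟨Nat.find hex, (Nat.find_spec hex).1, (Nat.find_spec hex).2,
    fun s hs h => Nat.find_min hex hs.2 ⟨hs.1, h⟩⟩

/-- The contents of the messages in `s` whose destination is `i`. -/
def addressedTo {ι M : Type*} [DecidableEq ι] (i : ι) (s : Multiset (ι × M)) : Multiset M :=
  (s.filter (·.1 = i)).map Prod.snd

theorem map_mk_addressedTo {ι M : Type*} [DecidableEq ι] (i : ι) (s : Multiset (ι × M)) :
    (addressedTo i s).map (Prod.mk i) = s.filter (·.1 = i) := by
  rw [addressedTo, Multiset.map_map]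
  refine (Multiset.map_congr rfl fun e he => ?_).trans (Multiset.map_id _)
  exact Prod.ext (Multiset.mem_filter.1 he).2.symm rfl

theorem sum_map_mk_addressedTo {ι M : Type*} [Fintype ι] [DecidableEq ι]
    (s : Multiset (ι × M)) : ∑ i, (addressedTo i s).map (Prod.mk i) = s := by
  classical
  ext e
  simp [map_mk_addressedTo, Multiset.count_sum', Multiset.count_filter]

namespace QuasiMetric

open Classical in
/-- The quasi-metric in which any two distinct comparable elements have distance `d`. -/
noncomputable def discrete (X : Type w) [SemilatticeSup X] (d : ℝ≥0∞) (hd : d ≠ 0) :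
    QuasiMetric X where
  dist a b := if a = b then 0 else if a ≤ b then d else ⊥
  eq_iff a b := by
    split_ifs <;> simp [*]
  le_iff a b := by
    split_ifs <;> simp [*]
  triangle a b c hab hbc := by
    obtain rfl | hab' := eq_or_ne a b
    · simp
    obtain rfl | hbc' := eq_or_ne b c
    · simp
    have hac : a ≠ c := ((hab.lt_of_ne hab').trans_le hbc).ne
    simp only [hab', hbc', hac, hab, hbc, hab.trans hbc, if_true, if_false]
    exact_mod_cast le_self_add

theorem discrete_dist_of_lt {X : Type w} [SemilatticeSup X] {d : ℝ≥0∞} (hd : d ≠ 0) {a b : X}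
    (h : a < b) : (discrete X d hd).dist a b = d := by
  simp [discrete, h.ne, h.le]

end QuasiMetric

theorem IsBoundedLatticeAgreement.output_eq_of_forall_le {n : ℕ} {X : Type w} [SemilatticeSup X]
    {δ : QuasiMetric X} {ε : ℝ≥0} {C : Set (Fin n)} {x y : Fin n → X}
    (h : IsBoundedLatticeAgreement δ ε C x y) {i : Fin n} (hi : i ∈ C) (hx : ∀ j, x j ≤ x i) :
    y i = x i :=
  le_antisymm ((h.upward i hi).trans (Finset.sup'_le _ _ fun j _ => hx j)) (h.downward i hi)

namespace Protocol

variable {n : ℕ} {X : Type w} {P : Protocol.{u, v} n X}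

namespace Run

variable {x : Fin n → X} {ρ : P.Run x} {i : Fin n}

theorem decision_mono {y : X} {t t' : ℕ} (h : t ≤ t')
    (hd : P.decision ((ρ.config t).state i) = some y) :
    P.decision ((ρ.config t').state i) = some y := by
  induction t', h using Nat.le_induction with
  | base => exact hd
  | succ t' _ ih =>
    rw [(ρ.step t').1]
    obtain rfl | h := eq_or_ne i (ρ.proc t')
    · simpa using P.decision_stable _ _ _ _ ih
    · simpa [h] using ih

theorem Decides.unique {y y' : X} (h : ρ.Decides i y) (h' : ρ.Decides i y') : y = y' := by
  obtain ⟨t, ht⟩ := h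
  obtain ⟨t', ht'⟩ := h'
  exact Option.some.inj <|
    (decision_mono (le_max_left t t') ht).symm.trans (decision_mono (le_max_right t t') ht')

end Run

section Fifo

variable (P)

/-- A configuration for executions with first-in first-out delivery: each process has a local state
and the queue of the messages in transit to it, oldest first. -/
abbrev FifoConfig := Fin n → P.State × List P.Msg

variable {P} in
/-- The configuration that results from forgetting the order of the messages in the queues. -/
def FifoConfig.toConfig (c : P.FifoConfig) : P.Config where
  state i := (c i).1
  buffer := ∑ i, ((c i).2 : Multiset P.Msg).map (Prod.mk i)

/-- Process `i` takes a step in which it receives the oldest message to it, if there is one. The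
messages it sends join the queues of their destinations, in an arbitrary order. -/
noncomputable def fifoStep (i : Fin n) (c : P.FifoConfig) : P.FifoConfig :=
  let r := P.step i (c i).1 (c i).2.head?
  let received := Function.update c i (r.1, (c i).2.tail)
  fun j => ((received j).1, (received j).2 ++ (addressedTo j r.2).toList)

/-- The execution with first-in first-out delivery on the inputs `x` in which process `σ t` takes a
step at time `t`. -/
noncomputable def fifo (x : Fin n → X) (σ : ℕ → Fin n) : ℕ → P.FifoConfig
  | 0 => fun i => (P.init i (x i), [])
  | t + 1 => P.fifoStep (σ t) (fifo x σ t)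

variable {P}

theorem FifoConfig.mem_buffer_toConfig {c : P.FifoConfig} {i : Fin n} {m : P.Msg} :
    (i, m) ∈ c.toConfig.buffer ↔ m ∈ (c i).2 := by
  simp [toConfig, Multiset.mem_sum]

theorem consumed_head?_add_map_tail (i : Fin n) (l : List P.Msg) :
    P.consumed i l.head? + (l.tail : Multiset P.Msg).map (Prod.mk i) =
      (l : Multiset P.Msg).map (Prod.mk i) := by
  cases l <;> simp [consumed]

theorem FifoConfig.buffer_toConfig_eq_consumed_add (c : P.FifoConfig) (i : Fin n) (s : P.State) :
    c.toConfig.buffer = P.consumed i (c i).2.head? +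
      (FifoConfig.toConfig (Function.update c i (s, (c i).2.tail))).buffer := by
  simp only [toConfig]
  rw [Fintype.sum_eq_add_sum_compl i, Fintype.sum_eq_add_sum_compl i, Function.update_self,
    ← add_assoc, consumed_head?_add_map_tail]
  congr 1
  refine Finset.sum_congr rfl fun j hj => ?_
  rw [Function.update_of_ne (by simpa using hj)]

theorem step_fifoStep (i : Fin n) (c : P.FifoConfig) :
    P.Step c.toConfig i (c i).2.head? (P.fifoStep i c).toConfig := by
  refine ⟨?_, _, c.buffer_toConfig_eq_consumed_add i (P.step i (c i).1 (c i).2.head?).1, ?_⟩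
  · ext j
    obtain rfl | hj := eq_or_ne j i
    · simp [FifoConfig.toConfig, fifoStep]
    · simp [FifoConfig.toConfig, fifoStep, hj]
  · simp only [FifoConfig.toConfig, fifoStep, ← Multiset.coe_add, Multiset.coe_toList,
      Multiset.map_add, Finset.sum_add_distrib, sum_map_mk_addressedTo]

theorem tail_queue_prefix_fifoStep (i : Fin n) (c : P.FifoConfig) :
    (c i).2.tail <+: (P.fifoStep i c i).2 := by
  simp [fifoStep]

theorem queue_prefix_fifoStep_of_ne {i j : Fin n} (h : j ≠ i) (c : P.FifoConfig) :
    (c j).2 <+: (P.fifoStep i c j).2 := by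
  simp [fifoStep, h]

theorem eqOn_fifoStep {S : Set (Fin n)} {c c' : P.FifoConfig} (h : EqOn c c' S) {i : Fin n}
    (hi : i ∈ S) : EqOn (P.fifoStep i c) (P.fifoStep i c') S := by
  intro j hj
  obtain rfl | hji := eq_or_ne j i
  · simp [fifoStep, h hi]
  · simp [fifoStep, h hi, h hj, hji]

variable {x x' : Fin n → X} {σ σ' : ℕ → Fin n} {i : Fin n}

theorem eqOn_fifo {S : Set (Fin n)} (hx : EqOn x x' S) {T : ℕ} (hS : ∀ t < T, σ t ∈ S)
    (hσ : ∀ t < T, σ t = σ' t) : EqOn (P.fifo x σ T) (P.fifo x' σ' T) S := by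
  induction T with
  | zero => exact fun i hi => by simp only [fifo, hx hi]
  | succ T ih =>
    simp only [fifo, ← hσ T T.lt_succ_self]
    exact eqOn_fifoStep (ih (fun t ht => hS t (ht.trans T.lt_succ_self))
      (fun t ht => hσ t (ht.trans T.lt_succ_self))) (hS T T.lt_succ_self)

theorem queue_prefix_fifo {t t' : ℕ} (htt' : t ≤ t') (h : ∀ s ∈ Ico t t', σ s ≠ i) :
    (P.fifo x σ t i).2 <+: (P.fifo x σ t' i).2 := by
  induction t', htt' using Nat.le_induction with
  | base => exact List.prefix_rfl
  | succ t' htt' ih =>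
    exact (ih fun s hs => h s ⟨hs.1, hs.2.trans t'.lt_succ_self⟩).trans <|
      queue_prefix_fifoStep_of_ne (h t' ⟨htt', t'.lt_succ_self⟩).symm _

theorem exists_receive_of_prefix (hi : ∃ᶠ t in atTop, σ t = i) {l : List P.Msg} {m : P.Msg}
    {t : ℕ} (h : l ++ [m] <+: (P.fifo x σ t i).2) :
    ∃ t', t ≤ t' ∧ σ t' = i ∧ (P.fifo x σ t' i).2.head? = some m := by
  induction l generalizing t with
  | nil =>
    obtain ⟨t', htt', ht', hne⟩ := exists_next_eq hi t
    obtain ⟨r, hr⟩ := h.trans (queue_prefix_fifo htt' hne)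
    exact ⟨t', htt', ht', by simp [← hr]⟩
  | cons m' l ih =>
    obtain ⟨t₁, htt₁, rfl, hne⟩ := exists_next_eq hi t
    obtain ⟨r, hr⟩ := h.trans (queue_prefix_fifo htt₁ hne)
    have htail : l ++ [m] <+: (P.fifo x σ t₁ (σ t₁)).2.tail := ⟨r, by simp [← hr]⟩
    obtain ⟨t', ht₁t', ht'⟩ := ih (t := t₁ + 1)
      (htail.trans (tail_queue_prefix_fifoStep _ _))
    exact ⟨t', by omega, ht'⟩

variable (P) in
/-- The execution `P.fifo x σ` as a run of the protocol. -/
noncomputable def fifoRun (x : Fin n → X) (σ : ℕ → Fin n) : P.Run x where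
  config t := (P.fifo x σ t).toConfig
  proc := σ
  recv t := (P.fifo x σ t (σ t)).2.head?
  init_state _ := rfl
  init_buffer := by simp [FifoConfig.toConfig, fifo]
  step t := step_fifoStep (σ t) (P.fifo x σ t)

theorem mem_correct_fifoRun : i ∈ (P.fifoRun x σ).correct ↔ ∃ᶠ t in atTop, σ t = i :=
  frequently_atTop.symm

theorem fifoRun_admissible {K : Set (Fin n)} (h : ∀ i ∉ K, ∃ᶠ t in atTop, σ t = i) {f : ℕ}
    (hK : K.ncard ≤ f) : (P.fifoRun x σ).Admissible f where
  faults := (ncard_le_ncard (compl_subset_comm.1 fun i hi => mem_correct_fifoRun.2 (h i hi))).trans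
    hK
  delivery i hi t m hm := by
    obtain ⟨l, r, hlr⟩ := List.append_of_mem (FifoConfig.mem_buffer_toConfig.1 hm)
    have hpre : l ++ [m] <+: (P.fifo x σ t i).2 := ⟨r, by simp [hlr]⟩
    obtain ⟨t', htt', rfl, hm'⟩ := exists_receive_of_prefix (mem_correct_fifoRun.1 hi) hpre
    exact ⟨t', htt', rfl, hm'⟩

theorem exists_forall_decides_fifoRun {S : Set (Fin n)} (hx : EqOn x x' S) (hS : ∀ t, σ t ∈ S)
    (hi : i ∈ S) {y : X} (h : (P.fifoRun x σ).Decides i y) :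
    ∃ T, ∀ σ', (∀ t < T, σ t = σ' t) → (P.fifoRun x' σ').Decides i y := by
  obtain ⟨T, hT⟩ := h
  refine ⟨T, fun σ' hσ => ⟨T, ?_⟩⟩
  have heq : P.fifo x σ T i = P.fifo x' σ' T i := eqOn_fifo hx (fun t _ => hS t) hσ hi
  simpa only [fifoRun, FifoConfig.toConfig, heq] using hT

end Fifo

section Solves

variable [SemilatticeSup X] {δ : QuasiMetric X} {f : ℕ} {ε : ℝ≥0} {x : Fin n → X}

theorem Solves.decides_of_forall_le (hP : P.Solves δ f ε) {ρ : P.Run x} (hρ : ρ.Admissible f)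
    {i : Fin n} (hi : i ∈ ρ.correct) (hx : ∀ j, x j ≤ x i) : ρ.Decides i (x i) := by
  obtain ⟨y, hdec, hy⟩ := hP x ρ hρ
  exact hy.output_eq_of_forall_le hi hx ▸ hdec i hi

theorem Solves.dist_le_of_decides (hP : P.Solves δ f ε) {ρ : P.Run x} (hρ : ρ.Admissible f)
    {i j : Fin n} (hi : i ∈ ρ.correct) (hj : j ∈ ρ.correct) {a b : X} (ha : ρ.Decides i a)
    (hb : ρ.Decides j b) (hab : a ≤ b) : δ.dist a b ≤ boundValue ε := by
  obtain ⟨y, hdec, hy⟩ := hP x ρ hρ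
  obtain rfl := (hdec i hi).unique ha
  obtain rfl := (hdec j hj).unique hb
  exact hy.tight i hi j hj hab

theorem Solves.exists_faultFree_run_decides (hP : P.Solves δ f ε) {K : Set (Fin n)}
    (hK : K.ncard ≤ f) {q : Fin n} (hq : q ∉ K) (hx : ∀ i ∉ K, x i ≤ x q) :
    ∃ ρ : P.Run x, ρ.Admissible f ∧ (∀ i, i ∈ ρ.correct) ∧ ρ.Decides q (x q) := by
  classical
  obtain ⟨σ, hσK, hσ⟩ := exists_seq_frequently_eq ⟨q, hq⟩ (to_countable Kᶜ)
  obtain ⟨κ, -, hκ⟩ := exists_seq_frequently_eq ⟨q, mem_univ q⟩ (to_countable univ)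
  let x' : Fin n → X := K.piecewise (fun _ => x q) x
  have hx'q : x' q = x q := piecewise_eq_of_notMem _ _ _ hq
  have hx'_le : ∀ i, x' i ≤ x' q := fun i => by
    by_cases hi : i ∈ K <;> simp [x', hi, hq, hx]
  have hcrash : (P.fifoRun x' σ).Decides q (x q) := hx'q ▸
    hP.decides_of_forall_le (fifoRun_admissible hσ hK) (mem_correct_fifoRun.2 (hσ q hq)) hx'_le
  obtain ⟨T, hT⟩ := exists_forall_decides_fifoRun (piecewise_eqOn_compl K _ x) hσK hq hcrash
  let τ : ℕ → Fin n := fun t => if t < T then σ t else κ t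
  have hτ : ∀ i, ∃ᶠ t in atTop, τ t = i := fun i => by
    refine (frequently_congr ?_).1 (hκ i (mem_univ i))
    filter_upwards [eventually_ge_atTop T] with t ht
    simp [τ, ht.not_gt]
  exact ⟨P.fifoRun x τ, fifoRun_admissible (fun i _ => hτ i) hK,
    fun i => mem_correct_fifoRun.2 (hτ i), hT τ fun t ht => (if_pos ht).symm⟩

theorem not_solves_of_boundValue_lt_dist (P : Protocol.{u, v} n X) (hf : 1 ≤ f) {p q : Fin n}
    (hpq : p ≠ q) {a b : X} (hab : a < b) (hδ : boundValue ε < δ.dist a b) :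
    ¬ P.Solves δ f ε := by
  intro hP
  let x : Fin n → X := Function.update (fun _ => a) p b
  have hxp : x p = b := Function.update_self ..
  have hx : ∀ i ≠ p, x i = a := fun i hi => Function.update_of_ne hi ..
  obtain ⟨ρ, hρ, hcorrect, hq⟩ := hP.exists_faultFree_run_decides (K := {p})
    ((ncard_singleton p).trans_le hf) hpq.symm
    (fun i hi => ((hx i hi).trans (hx q hpq.symm).symm).le)
  have hp : ρ.Decides p (x p) := hP.decides_of_forall_le hρ (hcorrect p) fun j => by
    obtain rfl | hj := eq_or_ne j p
    · exact le_rfl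
    · exact (hx j hj).trans_le (hab.le.trans hxp.ge)
  rw [hx q hpq.symm] at hq
  rw [hxp] at hp
  exact (hP.dist_le_of_decides hρ (hcorrect q) (hcorrect p) hq hp hab.le).not_gt hδ

end Solves

end Protocol

theorem mainTheorem3 (n f : ℕ) (hn : 2 ≤ n) (hf : 1 ≤ f) (ε : ℝ≥0) :
    (¬ ∃ P : ∀ (X : Type) [SemilatticeSup X] (_ : QuasiMetric X), Protocol.{u, v} n X,
      ∀ (X : Type) [SemilatticeSup X] (δ : QuasiMetric X), (P X δ).Solves δ f ε) ∧
    (∃ (X : Type) (_ : SemilatticeSup X) (_ : Finite X) (δ : QuasiMetric X) (x : Fin n → X),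
      (∃ i j, x i ≠ x j) ∧
      (∀ a ∈ supClosure (Set.range x), ∀ b ∈ supClosure (Set.range x),
        a < b → boundValue ε < δ.dist a b) ∧
      ∀ P : Protocol.{u, v} n X, ¬ P.Solves δ f ε) := by
  have : Nontrivial (Fin n) := Fin.nontrivial_iff_two_le.2 hn
  obtain ⟨p, q, hpq⟩ := exists_pair_ne (Fin n)
  let δ : QuasiMetric Bool := .discrete Bool (ε + 1) (by simp)
  have hδ : ∀ a b : Bool, a < b → boundValue ε < δ.dist a b := fun a b hab => by
    rw [QuasiMetric.discrete_dist_of_lt _ hab]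
    exact WithBot.coe_lt_coe.2 (ENNReal.lt_add_right ENNReal.coe_ne_top one_ne_zero)
  have hP : ∀ P : Protocol.{u, v} n Bool, ¬ P.Solves δ f ε := fun P =>
    P.not_solves_of_boundValue_lt_dist hf hpq Bool.false_lt_true (hδ _ _ Bool.false_lt_true)
  exact ⟨fun ⟨P, h⟩ => hP (P Bool δ) (h Bool δ), Bool, inferInstance, inferInstance, δ,
    Function.update (fun _ => false) p true, ⟨p, q, by simp [hpq.symm]⟩,
    fun a _ b _ => hδ a b, hP⟩
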